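/- Let $n\ge 1$, let $A\in\mathbb{R}^{n\times n}$ and $B\in\mathbb{R}^{n\times m}$ with $(A,B)$ controllable (i.e. $\operatorname{rank}[B, AB,\dots,A^{n-1}B]=n$), and let $Q\in\mathbb{R}^{n\times n}$ and $R\in\mathbb{R}^{m\times m}$ be symmetric positive definite. Let $\mathcal{G}=\{K\in\mathbb{R}^{m\times n} : A-BK \text{ is Hurwitz}\}$ be the set of stabilizing gains (Hurwitz: all eigenvalues have negative real part). For every $K\in\mathcal{G}$ the Lyapunov equation $$P_K(A-BK)+(A-BK)^\top P_K+K^\top RK+Q=0$$ has a unique solution $P_K\in\mathbb{R}^{n\times n}$, and the continuous-time LQR cost $J(K)=\operatorname{tr}(P_K)$ is differentiable on $\mathcal{G}$. Let $\nabla J$ be its gradient with respect to the Euclidean (Frobenius) inner product on $\mathbb{R}^{m\times n}$ and $\|\cdot\|$ the associated norm. Then $J$ never satisfies a global Polyak–Łojasiewicz inequality: there is no $\mu>0$ such that $$\|\nabla J(K)\|\ \ge\ \sqrt{\mu\,\bigl(J(K)-\underline J\bigr)}\qquad\text{for all } K\in\mathcal{G},$$ where $\underline J=\inf_{K\in\mathcal{G}}J(K)$.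 In particular, for any minimizer $K^*\in\mathcal{G}$ of $J$ over $\mathcal{G}$, there is no $\mu>0$ such that $\|\nabla J(K)\|\ge\sqrt{\mu\,(J(K)-J(K^*))}$ for all $K\in\mathcal{G}$. -/

import Mathlib

namespace CTLQR

open Matrix

/-- A real square matrix is Hurwitz if all its complex eigenvalues have negative real part. -/
def IsHurwitz {n : ℕ} (M : Matrix (Fin n) (Fin n) ℝ) : Prop :=
  ∀ z ∈ spectrum ℂ (M.map (algebraMap ℝ ℂ)), z.re < 0

/-- The controllability matrix `[B, AB, …, A^(n-1)B]`; its columns are indexed by pairs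
(power of `A`, column of `B`). -/
def controllabilityMatrix {n m : ℕ} (A : Matrix (Fin n) (Fin n) ℝ) (B : Matrix (Fin n) (Fin m) ℝ) :
    Matrix (Fin n) (Fin n × Fin m) ℝ :=
  Matrix.of fun i p => (A ^ (p.1 : ℕ) * B) i p.2

/-- The pair `(A, B)` is controllable (Kalman rank condition). -/
def IsControllable {n m : ℕ} (A : Matrix (Fin n) (Fin n) ℝ) (B : Matrix (Fin n) (Fin m) ℝ) : Prop :=
  (controllabilityMatrix A B).rank = n

/-- The set `𝒢` of stabilizing gains. -/
def stabilizing {n m : ℕ} (A : Matrix (Fin n) (Fin n) ℝ) (B : Matrix (Fin n) (Fin m) ℝ) :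
    Set (Matrix (Fin m) (Fin n) ℝ) :=
  {K | IsHurwitz (A - B * K)}

/-- `P` solves the closed-loop Lyapunov equation of the gain `K`. -/
def SolvesLyapunov {n m : ℕ} (A : Matrix (Fin n) (Fin n) ℝ) (B : Matrix (Fin n) (Fin m) ℝ)
    (Q : Matrix (Fin n) (Fin n) ℝ) (R : Matrix (Fin m) (Fin m) ℝ)
    (K : Matrix (Fin m) (Fin n) ℝ) (P : Matrix (Fin n) (Fin n) ℝ) : Prop :=
  P * (A - B * K) + (A - B * K)ᵀ * P + Kᵀ * R * K + Q = 0

open Classical in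
/-- `P_K`, the solution of the Lyapunov equation (unique when `K` is stabilizing; `0` if there is
no solution, which happens only for gains that are not stabilizing). -/
noncomputable def lyapunovP {n m : ℕ} (A : Matrix (Fin n) (Fin n) ℝ) (B : Matrix (Fin n) (Fin m) ℝ)
    (Q : Matrix (Fin n) (Fin n) ℝ) (R : Matrix (Fin m) (Fin m) ℝ)
    (K : Matrix (Fin m) (Fin n) ℝ) : Matrix (Fin n) (Fin n) ℝ :=
  if h : ∃ P, SolvesLyapunov A B Q R K P then h.choose else 0

/-- The LQR cost `J(K) = tr P_K`. -/
noncomputable def cost {n m : ℕ} (A : Matrix (Fin n) (Fin n) ℝ) (B : Matrix (Fin n) (Fin m) ℝ)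
    (Q : Matrix (Fin n) (Fin n) ℝ) (R : Matrix (Fin m) (Fin m) ℝ)
    (K : Matrix (Fin m) (Fin n) ℝ) : ℝ :=
  (lyapunovP A B Q R K).trace

/-- The gradient of a function of a matrix with respect to the Euclidean (Frobenius) inner product:
the matrix of its partial derivatives. -/
noncomputable def matrixGradient {m n : ℕ} (f : Matrix (Fin m) (Fin n) ℝ → ℝ)
    (K : Matrix (Fin m) (Fin n) ℝ) : Matrix (Fin m) (Fin n) ℝ :=
  Matrix.of fun i j => fderiv ℝ f K (Matrix.single i j 1)

/-- The Euclidean (Frobenius) norm of a matrix. -/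
noncomputable def frobeniusNorm {m n : ℕ} (M : Matrix (Fin m) (Fin n) ℝ) : ℝ :=
  Real.sqrt (∑ i, ∑ j, M i j ^ 2)

end CTLQR

/-
A function satisfying a Polyak–Łojasiewicz inequality relative to a lower bound `a` grows at least
quadratically away from `{f = a}`: the square root of `f - a` has slope bounded below, so by
Ekeland's argument it dominates a multiple of the distance to that set. The set `{J = a}` is bounded
because completing the square in the Lyapunov equation makes the sublevel sets of `J` compact, while
`ρ P_K` is a supersolution of the Lyapunov equation of `K + ρ R⁻¹ Bᵀ P_K` for `ρ ≥ 2`, so along this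
high-gain ray `J` grows at most linearly.
-/

namespace CTLQR

open Matrix Filter Topology

section PolyakLojasiewicz

theorem exists_forall_add_mul_dist_le {X : Type*} [PseudoMetricSpace X] {g : X → ℝ} {s : Set X}
    {c : ℝ} {x₁ : X} (hg : ContinuousOn g s) (hcpt : IsCompact {x | x ∈ s ∧ g x ≤ g x₁})
    (hc : 0 ≤ c) (hx₁ : x₁ ∈ s) :
    ∃ x ∈ s, ∀ y ∈ s, g x + c * dist x x₁ ≤ g y + c * dist y x₁ := by
  obtain ⟨x, ⟨hxs, -⟩, hmin⟩ := hcpt.exists_isMinOn ⟨x₁, hx₁, le_rfl⟩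
    (f := fun y => g y + c * dist y x₁) (ContinuousOn.mono (by fun_prop) fun y hy => hy.1)
  refine ⟨x, hxs, fun y hy => ?_⟩
  by_cases hle : g y ≤ g x₁
  · exact hmin ⟨hy, hle⟩
  · calc g x + c * dist x x₁ ≤ g x₁ + c * dist x₁ x₁ := hmin ⟨hx₁, le_rfl⟩
      _ ≤ g y + c * dist y x₁ := by
        rw [dist_self]
        gcongr
        · exact (not_le.mp hle).le
        · exact dist_nonneg

variable {E : Type*} [NormedAddCommGroup E] [NormedSpace ℝ E] {f : E → ℝ} {s : Set E}
  {a c μ : ℝ} {x : E}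

theorem norm_fderiv_le_of_eventually_sub_le (hf : DifferentiableAt ℝ f x) (hc : 0 ≤ c)
    (h : ∀ᶠ y in 𝓝 x, f x - c * ‖y - x‖ ≤ f y) : ‖fderiv ℝ f x‖ ≤ c := by
  have hlower (v : E) : -(c * ‖v‖) ≤ fderiv ℝ f x v := by
    have hray : Tendsto (fun t : ℝ => x + t • v) (𝓝[>] 0) (𝓝 x) :=
      (Continuous.tendsto' (by fun_prop) 0 x (by simp)).mono_left nhdsWithin_le_nhds
    refine ge_of_tendsto (hf.hasFDerivAt.hasLineDerivAt v).tendsto_slope_zero_right ?_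
    filter_upwards [hray.eventually h, self_mem_nhdsWithin] with t ht (ht0 : 0 < t)
    rw [add_sub_cancel_left, norm_smul, Real.norm_of_nonneg ht0.le] at ht
    rw [smul_eq_mul, inv_mul_eq_div, le_div_iff₀ ht0]
    linarith
  refine ContinuousLinearMap.opNorm_le_bound _ hc fun v => abs_le.mpr ⟨hlower v, ?_⟩
  have hneg := hlower (-v)
  rw [map_neg, norm_neg] at hneg
  linarith

theorem norm_fderiv_sqrt_sub (hf : DifferentiableAt ℝ f x) (hx : a < f x) :
    ‖fderiv ℝ (fun y => √(f y - a)) x‖ = ‖fderiv ℝ f x‖ / (2 * √(f x - a)) := by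
  rw [((hf.hasFDerivAt.sub_const a).sqrt (sub_pos.mpr hx).ne').fderiv, norm_smul,
    Real.norm_of_nonneg (by positivity), one_div_mul_eq_div]

/-- The Polyak–Łojasiewicz inequality for `f` on `s` with constant `μ`, relative to the value `a`
(not necessarily the infimum of `f` on `s`). -/
def PolyakLojasiewiczOn (f : E → ℝ) (s : Set E) (a μ : ℝ) : Prop :=
  ∀ x ∈ s, √(μ * (f x - a)) ≤ ‖fderiv ℝ f x‖

theorem PolyakLojasiewiczOn.half_sqrt_le_norm_fderiv_sqrt (h : PolyakLojasiewiczOn f s a μ)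
    (hμ : 0 ≤ μ) (hxs : x ∈ s) (hf : DifferentiableAt ℝ f x) (hx : a < f x) :
    √μ / 2 ≤ ‖fderiv ℝ (fun y => √(f y - a)) x‖ := by
  have hpos : 0 < √(f x - a) := Real.sqrt_pos.mpr (sub_pos.mpr hx)
  have hPL := h x hxs
  rw [Real.sqrt_mul hμ] at hPL
  rw [norm_fderiv_sqrt_sub hf hx, div_le_div_iff₀ two_pos (mul_pos two_pos hpos)]
  linarith

/-- Ekeland's argument: a minimizer of `√(f - a) + (√μ / 4) * dist · x₁` lies on `{f = a}`,
because elsewhere the slope of `√(f - a)` is at least `√μ / 2`. -/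
theorem PolyakLojasiewiczOn.exists_eq_and_dist_le (h : PolyakLojasiewiczOn f s a μ)
    (hμ : 0 < μ) (hs : IsOpen s) (hf : DifferentiableOn ℝ f s)
    (hcpt : ∀ b, IsCompact {x | x ∈ s ∧ f x ≤ b}) (ha : ∀ x ∈ s, a ≤ f x) {x₁ : E}
    (hx₁ : x₁ ∈ s) : ∃ x ∈ s, f x = a ∧ √μ / 4 * dist x x₁ ≤ √(f x₁ - a) := by
  have hsublevel : {x | x ∈ s ∧ √(f x - a) ≤ √(f x₁ - a)} = {x | x ∈ s ∧ f x ≤ f x₁} := by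
    ext x
    simp [Real.sqrt_le_sqrt_iff (sub_nonneg.mpr (ha x₁ hx₁))]
  obtain ⟨x, hx, hmin⟩ := exists_forall_add_mul_dist_le (g := fun x => √(f x - a))
    (hf.continuousOn.sub continuousOn_const).sqrt (hsublevel ▸ hcpt (f x₁))
    (by positivity : 0 ≤ √μ / 4) hx₁
  have hfx := hf.differentiableAt (hs.mem_nhds hx)
  refine ⟨x, hx, ?_, ?_⟩
  · by_contra hne
    have hlt : a < f x := (ha x hx).lt_of_ne' hne
    have hslope : ‖fderiv ℝ (fun y => √(f y - a)) x‖ ≤ √μ / 4 := by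
      refine norm_fderiv_le_of_eventually_sub_le
        ((hfx.sub_const a).sqrt (sub_pos.mpr hlt).ne') (by positivity) ?_
      filter_upwards [hs.mem_nhds hx] with y hy
      have hxy := hmin y hy
      have htri := mul_le_mul_of_nonneg_left (dist_triangle y x x₁)
        (by positivity : 0 ≤ √μ / 4)
      rw [dist_eq_norm y x] at htri
      linarith
    have hsteep := h.half_sqrt_le_norm_fderiv_sqrt hμ.le hx hfx hlt
    linarith [Real.sqrt_pos.mpr hμ]
  · have hx₁x := hmin x₁ hx₁
    rw [dist_self, mul_zero, add_zero] at hx₁x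
    linarith [Real.sqrt_nonneg (f x - a)]

theorem eventually_sqrt_mul_add_lt_mul_sub {κ : ℝ} (hκ : 0 < κ) (C b D : ℝ) :
    ∀ᶠ ρ : ℝ in atTop, √(ρ * C + b) < κ * ρ - D := by
  have hlin : Tendsto (fun ρ => κ * ρ - D) atTop atTop :=
    tendsto_atTop_add_const_right _ _ (tendsto_id.const_mul_atTop hκ)
  have hquad : Tendsto (fun ρ => ρ * (κ ^ 2 * ρ - (2 * κ * D + C))) atTop atTop :=
    tendsto_id.atTop_mul_atTop₀
      (tendsto_atTop_add_const_right _ _ (tendsto_id.const_mul_atTop (by positivity)))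
  filter_upwards [hlin.eventually_gt_atTop 0,
    hquad.eventually_gt_atTop (b - D ^ 2)] with ρ hlinρ hquadρ
  rw [Real.sqrt_lt' hlinρ]
  linarith

theorem not_polyakLojasiewiczOn_of_ray {x₀ v : E} {C : ℝ} (hs : IsOpen s)
    (hf : DifferentiableOn ℝ f s) (hcpt : ∀ b, IsCompact {x | x ∈ s ∧ f x ≤ b})
    (ha : ∀ x ∈ s, a ≤ f x) (hv : v ≠ 0)
    (hray : ∀ᶠ ρ : ℝ in atTop, x₀ + ρ • v ∈ s ∧ f (x₀ + ρ • v) ≤ ρ * C) (hμ : 0 < μ) :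
    ¬ PolyakLojasiewiczOn f s a μ := by
  intro h
  obtain ⟨D, hD⟩ := (hcpt a).isBounded.subset_closedBall x₀
  have hκ : 0 < √μ / 4 * ‖v‖ := by positivity
  obtain ⟨ρ, ⟨hmem, hle⟩, hlt, hρ⟩ := (hray.and ((eventually_sqrt_mul_add_lt_mul_sub hκ C (-a)
    (√μ / 4 * D)).and (eventually_ge_atTop 0))).exists
  obtain ⟨x, hx, hfx, hdist⟩ := h.exists_eq_and_dist_le hμ hs hf hcpt ha hmem
  have hnear : dist x x₀ ≤ D := hD ⟨hx, hfx.le⟩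
  have hfar : ρ * ‖v‖ - D ≤ dist x (x₀ + ρ • v) := by
    have htri := dist_triangle_left x₀ (x₀ + ρ • v) x
    rw [dist_self_add_right, norm_smul, Real.norm_of_nonneg hρ] at htri
    linarith
  have hsqrt : √(f (x₀ + ρ • v) - a) ≤ √(ρ * C + -a) := Real.sqrt_le_sqrt (by linarith)
  linarith [mul_le_mul_of_nonneg_left hfar (by positivity : 0 ≤ √μ / 4)]

end PolyakLojasiewicz

open scoped Matrix.Norms.Frobenius

section RealMatrix

variable {ι κ : Type*} [Fintype κ]

theorem posSemidef_transpose_mul_mul_same [Finite ι] {R : Matrix κ κ ℝ} (hR : R.PosSemidef)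
    (Y : Matrix κ ι ℝ) : (Yᵀ * R * Y).PosSemidef :=
  conjTranspose_eq_transpose_of_trivial Y ▸ hR.conjTranspose_mul_mul_same Y

theorem posSemidef_mul_transpose_self [Finite ι] (Y : Matrix ι κ ℝ) : (Y * Yᵀ).PosSemidef :=
  conjTranspose_eq_transpose_of_trivial Y ▸ posSemidef_self_mul_conjTranspose Y

theorem isClosed_setOf_posSemidef [Finite ι] : IsClosed {P : Matrix ι ι ℝ | P.PosSemidef} := by
  cases nonempty_fintype ι
  simp only [posSemidef_iff_dotProduct_mulVec, Matrix.IsHermitian, Set.ofPred_and,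
    Set.ofPred_forall, star_trivial]
  exact (isClosed_eq (by fun_prop) (by fun_prop)).inter
    (isClosed_iInter fun x => isClosed_le (by fun_prop) (by fun_prop))

variable [Fintype ι]

theorem isOpen_setOf_forall_dotProduct_mulVec_pos :
    IsOpen {M : Matrix ι ι ℝ | ∀ x : ι → ℝ, x ≠ 0 → 0 < x ⬝ᵥ M *ᵥ x} := by
  have hsphere : {M : Matrix ι ι ℝ | ∀ x : ι → ℝ, x ≠ 0 → 0 < x ⬝ᵥ M *ᵥ x} =
      {M | ∀ x ∈ Metric.sphere (0 : ι → ℝ) 1, 0 < x ⬝ᵥ M *ᵥ x} := by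
    ext M
    refine ⟨fun h x hx => h x (ne_zero_of_mem_unit_sphere ⟨x, hx⟩), fun h x hx => ?_⟩
    have hpos : 0 < ‖x‖ := norm_pos_iff.mpr hx
    have hunit := h (‖x‖⁻¹ • x) (by simp [norm_smul, hx])
    simpa [mulVec_smul, smul_dotProduct, dotProduct_smul, hpos] using hunit
  rw [hsphere, isOpen_iff_eventually]
  intro M hM
  have hcont : Continuous fun p : Matrix ι ι ℝ × (ι → ℝ) => p.2 ⬝ᵥ p.1 *ᵥ p.2 := by fun_prop
  exact (isCompact_sphere _ _).eventually_forall_of_forall_eventually fun x hx =>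
    hcont.continuousAt.eventually_const_lt (hM x hx)

theorem posDef_of_isUnit_of_preconnectedSpace [DecidableEq ι] {X : Type*} [TopologicalSpace X]
    [PreconnectedSpace X] {P : X → Matrix ι ι ℝ} (hP : Continuous P)
    (hherm : ∀ t, (P t).IsHermitian) (hunit : ∀ t, IsUnit (P t)) {t₀ : X}
    (ht₀ : (P t₀).PosDef) (t : X) : (P t).PosDef := by
  have hopen : {t | (P t).PosDef} =
      P ⁻¹' {M | ∀ x : ι → ℝ, x ≠ 0 → 0 < x ⬝ᵥ M *ᵥ x} := by
    ext t
    simp only [Set.mem_ofPred_eq, Set.mem_preimage, posDef_iff_dotProduct_mulVec, hherm t, true_and,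
      star_trivial, ne_eq]
  have hclosed : {t | (P t).PosDef} = P ⁻¹' {M | M.PosSemidef} := by
    ext t
    exact ⟨PosDef.posSemidef, fun h => h.posDef_iff_isUnit.mpr (hunit t)⟩
  have hclopen : IsClopen {t | (P t).PosDef} :=
    ⟨hclosed ▸ isClosed_setOf_posSemidef.preimage hP,
      hopen ▸ isOpen_setOf_forall_dotProduct_mulVec_pos.preimage hP⟩
  exact Set.eq_univ_iff_forall.mp (hclopen.eq_univ ⟨t₀, ht₀⟩) t

theorem norm_sq_eq_trace_transpose_mul_self (Y : Matrix κ ι ℝ) : ‖Y‖ ^ 2 = (Yᵀ * Y).trace := by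
  rw [frobenius_norm_def, ← Real.sqrt_eq_rpow, Real.sq_sqrt (by positivity), Finset.sum_comm]
  simp [trace, mul_apply, sq]

open scoped MatrixOrder in
theorem exists_eq_transpose_mul_self_of_posSemidef {P : Matrix ι ι ℝ} (hP : P.PosSemidef) :
    ∃ C : Matrix ι ι ℝ, P = Cᵀ * C := by
  classical
  obtain ⟨C, hC⟩ := CStarAlgebra.nonneg_iff_eq_star_mul_self.mp hP.nonneg
  exact ⟨C, by rw [hC, star_eq_conjTranspose, conjTranspose_eq_transpose_of_trivial]⟩

theorem norm_le_trace_of_posSemidef {P : Matrix ι ι ℝ} (hP : P.PosSemidef) : ‖P‖ ≤ P.trace := by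
  obtain ⟨C, rfl⟩ := exists_eq_transpose_mul_self_of_posSemidef hP
  rw [← norm_sq_eq_trace_transpose_mul_self, sq]
  exact (frobenius_norm_mul Cᵀ C).trans_eq (by rw [frobenius_norm_transpose])

theorem isCompact_setOf_posSemidef_trace_le (a : ℝ) :
    IsCompact {P : Matrix ι ι ℝ | P.PosSemidef ∧ P.trace ≤ a} := by
  refine Metric.isCompact_of_isClosed_isBounded
    (isClosed_setOf_posSemidef.inter (isClosed_le (f := trace) (by fun_prop) continuous_const))
    (isBounded_iff_forall_norm_le.mpr ⟨a, ?_⟩)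
  rintro P ⟨hP, ha⟩
  exact (norm_le_trace_of_posSemidef hP).trans ha

theorem exists_norm_sq_le_mul_trace {R : Matrix κ κ ℝ} (hR : R.PosDef) :
    ∃ c : ℝ, 0 ≤ c ∧ ∀ Y : Matrix κ ι ℝ, ‖Y‖ ^ 2 ≤ c * (Yᵀ * R * Y).trace := by
  classical
  obtain ⟨C, rfl⟩ := exists_eq_transpose_mul_self_of_posSemidef hR.posSemidef
  have hC : IsUnit C.det := by
    have hdet := hR.det_pos.ne'
    rw [det_mul] at hdet
    exact (right_ne_zero_of_mul hdet).isUnit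
  refine ⟨‖C⁻¹‖ ^ 2, by positivity, fun Y => ?_⟩
  calc ‖Y‖ ^ 2 = ‖C⁻¹ * (C * Y)‖ ^ 2 := by rw [nonsing_inv_mul_cancel_left _ _ hC]
    _ ≤ (‖C⁻¹‖ * ‖C * Y‖) ^ 2 := by gcongr; exact frobenius_norm_mul _ _
    _ = ‖C⁻¹‖ ^ 2 * (Yᵀ * (Cᵀ * C) * Y).trace := by
      rw [mul_pow, norm_sq_eq_trace_transpose_mul_self (C * Y), transpose_mul, Matrix.mul_assoc,
        Matrix.mul_assoc, Matrix.mul_assoc]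

end RealMatrix

section Differentiability

variable {E ι κ ν : Type*} [NormedAddCommGroup E] [NormedSpace ℝ E] {x : E}

theorem differentiableAt_inverse_apply {V W : Type*} [NormedAddCommGroup V] [NormedSpace ℝ V]
    [CompleteSpace V] [NormedAddCommGroup W] [NormedSpace ℝ W] {L : E → V →L[ℝ] W} {w : E → W}
    (hx : (L x).IsInvertible) (hL : DifferentiableAt ℝ L x) (hw : DifferentiableAt ℝ w x) :
    DifferentiableAt ℝ (fun y => (L y).inverse (w y)) x := by
  have hinv : DifferentiableAt ℝ (fun y => (L y).inverse) x :=
    DifferentiableAt.comp (f := L) x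
      ((hx.contDiffAt_map_inverse (n := 1)).differentiableAt one_ne_zero) hL
  exact hinv.clm_apply hw

theorem differentiableAt_transpose [Finite ι] [Finite κ] {F : E → Matrix κ ι ℝ}
    (hF : DifferentiableAt ℝ F x) : DifferentiableAt ℝ (fun y => (F y)ᵀ) x := by
  cases nonempty_fintype ι
  cases nonempty_fintype κ
  exact (transposeLinearEquiv κ ι ℝ ℝ).toLinearMap.toContinuousLinearMap.differentiableAt.comp x hF

theorem differentiableAt_mul [Finite κ] [Fintype ι] [Finite ν] {F : E → Matrix κ ι ℝ}
    {G : E → Matrix ι ν ℝ} (hF : DifferentiableAt ℝ F x) (hG : DifferentiableAt ℝ G x) :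
    DifferentiableAt ℝ (fun y => F y * G y) x := by
  cases nonempty_fintype κ
  cases nonempty_fintype ν
  have hbound (X : Matrix κ ι ℝ) (Y : Matrix ι ν ℝ) : ‖mulLinearMap ℝ X Y‖ ≤ 1 * ‖X‖ * ‖Y‖ := by
    rw [one_mul]
    exact frobenius_norm_mul X Y
  exact ((mulLinearMap ℝ).mkContinuous₂ 1 hbound).isBoundedBilinearMap.differentiableAt (F x, G x)
    |>.comp x (hF.prodMk hG)

end Differentiability

section LyapunovEquation

variable {ι : Type*} [Fintype ι] [DecidableEq ι] {M P W : Matrix ι ι ℝ}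

/-- The Lyapunov operator `P ↦ P M + Mᵀ P`, as a continuous linear map for the Frobenius norm so
that its inverse depends smoothly on `M`. -/
noncomputable def lyapunovMap (M : Matrix ι ι ℝ) : Matrix ι ι ℝ →L[ℝ] Matrix ι ι ℝ :=
  (ContinuousLinearMap.mul ℝ (Matrix ι ι ℝ)).flip M + ContinuousLinearMap.mul ℝ (Matrix ι ι ℝ) Mᵀ

theorem lyapunovMap_apply (M P : Matrix ι ι ℝ) : lyapunovMap M P = P * M + Mᵀ * P := rfl

/-- The solution `P` of `P M + Mᵀ P + W = 0` (`0` if the Lyapunov operator of `M` is not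
invertible). -/
noncomputable def lyapunovSolution (M W : Matrix ι ι ℝ) : Matrix ι ι ℝ :=
  (lyapunovMap M).inverse (-W)

theorem eq_lyapunovSolution_iff (hM : (lyapunovMap M).IsInvertible) :
    P = lyapunovSolution M W ↔ P * M + Mᵀ * P + W = 0 := by
  rw [lyapunovSolution, eq_comm, hM.inverse_apply_eq, lyapunovMap_apply, eq_comm,
    eq_neg_iff_add_eq_zero]

theorem lyapunovSolution_spec (hM : (lyapunovMap M).IsInvertible) (W : Matrix ι ι ℝ) :
    lyapunovSolution M W * M + Mᵀ * lyapunovSolution M W + W = 0 :=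
  (eq_lyapunovSolution_iff hM).mp rfl

theorem isSymm_of_lyapunov (hM : (lyapunovMap M).IsInvertible) (hW : W.IsSymm)
    (h : P * M + Mᵀ * P + W = 0) : P.IsSymm := by
  have htranspose : Pᵀ * M + Mᵀ * Pᵀ + W = 0 := by
    simpa [hW.eq, add_comm (Mᵀ * Pᵀ)] using congrArg transpose h
  rw [IsSymm, (eq_lyapunovSolution_iff hM).mpr htranspose, ← (eq_lyapunovSolution_iff hM).mpr h]

theorem differentiableAt_lyapunovSolution {E : Type*} [NormedAddCommGroup E] [NormedSpace ℝ E]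
    {F G : E → Matrix ι ι ℝ} {x : E} (hx : (lyapunovMap (F x)).IsInvertible)
    (hF : DifferentiableAt ℝ F x) (hG : DifferentiableAt ℝ G x) :
    DifferentiableAt ℝ (fun y => lyapunovSolution (F y) (G y)) x := by
  have hmap : DifferentiableAt ℝ (fun y => lyapunovMap (F y)) x :=
    ((ContinuousLinearMap.mul ℝ (Matrix ι ι ℝ)).flip.differentiableAt.comp x hF).add
      ((ContinuousLinearMap.mul ℝ (Matrix ι ι ℝ)).differentiableAt.comp x
        (differentiableAt_transpose hF))
  exact differentiableAt_inverse_apply hx hmap hG.neg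

omit [DecidableEq ι] in
theorem two_mul_dotProduct_of_lyapunov (hP : P.IsSymm) (h : P * M + Mᵀ * P + W = 0)
    (x : ι → ℝ) : 2 * (P *ᵥ x ⬝ᵥ M *ᵥ x) = -(x ⬝ᵥ W *ᵥ x) := by
  have hform := congrArg (fun X => x ⬝ᵥ X *ᵥ x) h
  simp only [add_mulVec, dotProduct_add, zero_mulVec, dotProduct_zero, ← mulVec_mulVec,
    dotProduct_mulVec x P, dotProduct_mulVec x Mᵀ, ← mulVec_transpose P, hP.eq,
    vecMul_transpose, dotProduct_comm (M *ᵥ x)] at hform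
  linarith

omit [DecidableEq ι] in
theorem mulVec_eq_zero_of_lyapunov (hP : P.IsSymm) (hW : W.PosSemidef)
    (h : P * M + Mᵀ * P + W = 0) {x : ι → ℝ} (hx : P *ᵥ x = 0) :
    W *ᵥ x = 0 ∧ P *ᵥ (M *ᵥ x) = 0 := by
  have hform := two_mul_dotProduct_of_lyapunov hP h x
  rw [hx, zero_dotProduct, mul_zero, eq_comm, neg_eq_zero] at hform
  have hWx : W *ᵥ x = 0 := (hW.dotProduct_mulVec_zero_iff x).mp hform
  refine ⟨hWx, ?_⟩
  simpa only [add_mulVec, ← mulVec_mulVec, hx, hWx, mulVec_zero, add_zero, zero_mulVec] using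
    congrArg (· *ᵥ x) h

theorem isUnit_of_lyapunov (hP : P.IsSymm) (hW : W.PosDef) (h : P * M + Mᵀ * P + W = 0) :
    IsUnit P := by
  rw [isUnit_iff_isUnit_det, isUnit_iff_ne_zero, ne_eq, ← exists_mulVec_eq_zero_iff]
  rintro ⟨x, hx, hPx⟩
  have hpos : 0 < x ⬝ᵥ W *ᵥ x := hW.dotProduct_mulVec_pos hx
  rw [(mulVec_eq_zero_of_lyapunov hP hW.posSemidef h hPx).1, dotProduct_zero] at hpos
  exact hpos.false

end LyapunovEquation

section Hurwitz

theorem mem_spectrum_iff_exists_mulVec_eq_smul {𝕜 ι : Type*} [Field 𝕜] [Fintype ι]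
    [DecidableEq ι] {N : Matrix ι ι 𝕜} {z : 𝕜} :
    z ∈ spectrum 𝕜 N ↔ ∃ v, v ≠ 0 ∧ N *ᵥ v = z • v := by
  rw [spectrum.mem_iff, isUnit_iff_isUnit_det, isUnit_iff_ne_zero, not_not,
    ← exists_mulVec_eq_zero_iff]
  simp only [sub_mulVec, Algebra.algebraMap_eq_smul_one, smul_mulVec, one_mulVec, sub_eq_zero,
    eq_comm]

theorem eq_zero_of_mul_eq_mul_of_disjoint_spectrum {𝕜 ι κ : Type*} [Field 𝕜] [IsAlgClosed 𝕜]
    [Fintype ι] [DecidableEq ι] [Fintype κ] [DecidableEq κ] {N : Matrix κ κ 𝕜} {M : Matrix ι ι 𝕜}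
    {P : Matrix κ ι 𝕜} (h : N * P = P * M) (hd : Disjoint (spectrum 𝕜 M) (spectrum 𝕜 N)) :
    P = 0 := by
  have haeval (p : Polynomial 𝕜) : Polynomial.aeval N p * P = P * Polynomial.aeval M p := by
    induction p using Polynomial.induction_on with
    | C a => simp [Algebra.algebraMap_eq_smul_one]
    | add p q hp hq => simp only [map_add, Matrix.add_mul, Matrix.mul_add, hp, hq]
    | monomial k a hk =>
      simp only [pow_succ, ← mul_assoc, map_mul (Polynomial.aeval N) _ Polynomial.X,
        map_mul (Polynomial.aeval M) _ Polynomial.X, Polynomial.aeval_X]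
      rw [Matrix.mul_assoc, h, ← Matrix.mul_assoc, hk, Matrix.mul_assoc]
  have hunit : IsUnit (Polynomial.aeval N M.charpoly) := by
    by_contra hnot
    rw [(IsAlgClosed.splits M.charpoly).eq_prod_roots_of_monic M.charpoly_monic] at hnot
    obtain ⟨k, hk, hroot⟩ := spectrum.exists_mem_of_not_isUnit_aeval_prod hnot
    exact Set.disjoint_left.mp hd (mem_spectrum_iff_isRoot_charpoly.mpr hroot) hk
  have hker := haeval M.charpoly
  rw [aeval_self_charpoly, Matrix.mul_zero] at hker
  rw [← nonsing_inv_mul_cancel_left _ P ((isUnit_iff_isUnit_det _).mp hunit), hker,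
    Matrix.mul_zero]

variable {n : ℕ} {M P W : Matrix (Fin n) (Fin n) ℝ}

theorem isHurwitz_iff_forall_mulVec : IsHurwitz M ↔ ∀ (z : ℂ) (v : Fin n → ℂ), v ≠ 0 →
    M.map (algebraMap ℝ ℂ) *ᵥ v = z • v → z.re < 0 := by
  simp only [IsHurwitz, mem_spectrum_iff_exists_mulVec_eq_smul]
  exact ⟨fun h z v hv hz => h z ⟨v, hv, hz⟩, fun h z ⟨v, hv, hz⟩ => h z v hv hz⟩

theorem IsHurwitz.transpose (hM : IsHurwitz M) : IsHurwitz Mᵀ := by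
  intro z hz
  rw [transpose_map, mem_spectrum_iff_isRoot_charpoly, charpoly_transpose,
    ← mem_spectrum_iff_isRoot_charpoly] at hz
  exact hM z hz

theorem map_smul_sub_smul_one_mulVec (M : Matrix (Fin n) (Fin n) ℝ) (t c : ℝ) (v : Fin n → ℂ) :
    (t • M - c • (1 : Matrix (Fin n) (Fin n) ℝ)).map (algebraMap ℝ ℂ) *ᵥ v =
      t • (M.map (algebraMap ℝ ℂ) *ᵥ v) - c • v := by
  have hmap : (t • M - c • (1 : Matrix (Fin n) (Fin n) ℝ)).map (algebraMap ℝ ℂ) =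
      t • M.map (algebraMap ℝ ℂ) - c • (1 : Matrix (Fin n) (Fin n) ℂ) := by
    ext i j
    rcases eq_or_ne i j with rfl | hij <;> simp [*]
  rw [hmap, sub_mulVec, smul_mulVec, smul_mulVec, one_mulVec]

theorem IsHurwitz.smul_sub_smul_one (hM : IsHurwitz M) {t c : ℝ} (ht : 0 ≤ t) (hc : 0 ≤ c)
    (htc : 0 < t + c) : IsHurwitz (t • M - c • (1 : Matrix (Fin n) (Fin n) ℝ)) := by
  rw [isHurwitz_iff_forall_mulVec] at hM ⊢
  intro z v hv hz
  rw [map_smul_sub_smul_one_mulVec, sub_eq_iff_eq_add, ← Complex.coe_smul c, ← add_smul] at hz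
  rcases ht.eq_or_lt with rfl | ht
  · rw [zero_smul, eq_comm, smul_eq_zero, or_iff_left hv] at hz
    have hre : z.re + c = 0 := by simpa using congrArg Complex.re hz
    linarith
  · have hre := hM ((t : ℂ)⁻¹ * (z + c)) v hv (by
      rw [mul_smul, ← hz, ← Complex.coe_smul, inv_smul_smul₀ (by exact_mod_cast ht.ne')])
    rw [← Complex.ofReal_inv, Complex.re_ofReal_mul, Complex.add_re, Complex.ofReal_re] at hre
    linarith [neg_of_mul_neg_right hre (inv_pos.mpr ht).le]

theorem exists_isHurwitz_sub_smul_one (M : Matrix (Fin n) (Fin n) ℝ) :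
    ∃ c : ℝ, 0 < c ∧ IsHurwitz (M - c • (1 : Matrix (Fin n) (Fin n) ℝ)) := by
  obtain ⟨b, hb⟩ := ((finite_spectrum (M.map (algebraMap ℝ ℂ))).image Complex.re).bddAbove
  refine ⟨|b| + 1, by positivity, isHurwitz_iff_forall_mulVec.mpr fun z v hv hz => ?_⟩
  have hshift := map_smul_sub_smul_one_mulVec M 1 (|b| + 1) v
  rw [one_smul, one_smul, hz, eq_sub_iff_add_eq, ← Complex.coe_smul, ← add_smul] at hshift
  have hle := hb ⟨_, mem_spectrum_iff_exists_mulVec_eq_smul.mpr ⟨v, hv, hshift.symm⟩, rfl⟩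
  rw [Complex.add_re, Complex.ofReal_re] at hle
  linarith [le_abs_self b]

theorem IsHurwitz.isInvertible_lyapunovMap (hM : IsHurwitz M) : (lyapunovMap M).IsInvertible := by
  have hinj : Function.Injective (lyapunovMap M).toLinearMap := by
    rw [injective_iff_map_eq_zero]
    intro P hP
    have hP : P * M + Mᵀ * P = 0 := hP
    have hintertwine : (-Mᵀ).map (algebraMap ℝ ℂ) * P.map (algebraMap ℝ ℂ) =
        P.map (algebraMap ℝ ℂ) * M.map (algebraMap ℝ ℂ) := by
      rw [← Matrix.map_mul, ← Matrix.map_mul, Matrix.neg_mul, eq_neg_of_add_eq_zero_left hP]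
    have hdisj : Disjoint (spectrum ℂ (M.map (algebraMap ℝ ℂ)))
        (spectrum ℂ ((-Mᵀ).map (algebraMap ℝ ℂ))) := by
      rw [Set.disjoint_left]
      intro z hz hz'
      rw [Matrix.map_neg _ (map_neg _), ← spectrum.neg_eq, Set.mem_neg] at hz'
      have hneg : -z.re < 0 := hM.transpose (-z) hz'
      linarith [hM z hz]
    exact map_injective (algebraMap ℝ ℂ).injective <|
      (eq_zero_of_mul_eq_mul_of_disjoint_spectrum hintertwine hdisj).trans
        (Matrix.map_zero _ (map_zero _)).symm
  exact ⟨(LinearEquiv.ofInjectiveEndo _ hinj).toContinuousLinearEquiv, rfl⟩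

/-- Along the homotopy `t M - (1 - t)` from `-1` to `M` the solution stays invertible, so it cannot
lose the definiteness of its initial value `W / 2`. -/
theorem IsHurwitz.posDef_lyapunovSolution (hM : IsHurwitz M) (hW : W.PosDef) :
    (lyapunovSolution M W).PosDef := by
  let N (t : ℝ) : Matrix (Fin n) (Fin n) ℝ := t • M - (1 - t) • (1 : Matrix (Fin n) (Fin n) ℝ)
  have hN (t : unitInterval) : (lyapunovMap (N t)).IsInvertible :=
    (hM.smul_sub_smul_one t.2.1 (sub_nonneg.mpr t.2.2) (by simp)).isInvertible_lyapunovMap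
  have hsymm (t : unitInterval) : (lyapunovSolution (N t) W).IsSymm :=
    isSymm_of_lyapunov (hN t) (isHermitian_iff_isSymm.mp hW.isHermitian)
      (lyapunovSolution_spec (hN t) W)
  have hcont : Continuous fun t : unitInterval => lyapunovSolution (N t) W :=
    continuous_iff_continuousAt.mpr fun t =>
      (differentiableAt_lyapunovSolution (hN t) (by fun_prop)
        (differentiableAt_const W)).continuousAt.comp continuous_subtype_val.continuousAt
  have hzero : lyapunovSolution (N (0 : unitInterval)) W = (2⁻¹ : ℝ) • W := by
    refine ((eq_lyapunovSolution_iff (hN 0)).mpr ?_).symm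
    simp only [N, Set.Icc.coe_zero, zero_smul, sub_zero, one_smul, zero_sub, transpose_neg,
      transpose_one, Matrix.mul_neg, Matrix.neg_mul, Matrix.mul_one, Matrix.one_mul]
    module
  have hone := posDef_of_isUnit_of_preconnectedSpace hcont
    (fun t => isHermitian_iff_isSymm.mpr (hsymm t))
    (fun t => isUnit_of_lyapunov (hsymm t) hW (lyapunovSolution_spec (hN t) W))
    (t₀ := 0) (hzero ▸ hW.smul (by norm_num)) 1
  simpa [N] using hone

theorem IsHurwitz.posSemidef_lyapunovSolution (hM : IsHurwitz M) (hW : W.PosSemidef) :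
    (lyapunovSolution M W).PosSemidef := by
  have hinv := hM.isInvertible_lyapunovMap
  have hcont : Tendsto (fun ε : ℝ => lyapunovSolution M (W + ε • 1)) (𝓝[>] 0)
      (𝓝 (lyapunovSolution M W)) := by
    have hat := (differentiableAt_lyapunovSolution (F := fun _ : ℝ => M) (x := 0)
      (G := fun ε => W + ε • (1 : Matrix (Fin n) (Fin n) ℝ)) hinv (by fun_prop)
      (by fun_prop)).continuousAt.tendsto
    simp only [zero_smul, add_zero] at hat
    exact hat.mono_left nhdsWithin_le_nhds
  refine isClosed_setOf_posSemidef.mem_of_tendsto hcont ?_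
  filter_upwards [self_mem_nhdsWithin] with ε hε
  exact (hM.posDef_lyapunovSolution (PosDef.posSemidef_add hW (PosDef.one.smul hε))).posSemidef

theorem re_mulVec_of_map_mulVec_eq_smul {z : ℂ} {v : Fin n → ℂ}
    (h : M.map (algebraMap ℝ ℂ) *ᵥ v = z • v) :
    M *ᵥ (fun i => (v i).re) = z.re • (fun i => (v i).re) - z.im • fun i => (v i).im := by
  ext i
  simpa [mulVec, dotProduct] using congrArg Complex.re (congrFun h i)

theorem im_mulVec_of_map_mulVec_eq_smul {z : ℂ} {v : Fin n → ℂ}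
    (h : M.map (algebraMap ℝ ℂ) *ᵥ v = z • v) :
    M *ᵥ (fun i => (v i).im) = z.re • (fun i => (v i).im) + z.im • fun i => (v i).re := by
  ext i
  simpa [mulVec, dotProduct] using congrArg Complex.im (congrFun h i)

theorem isHurwitz_of_forall_dotProduct_neg (hP : P.PosSemidef)
    (h : ∀ x, x ≠ 0 → P *ᵥ x ⬝ᵥ M *ᵥ x < 0) : IsHurwitz M := by
  rw [isHurwitz_iff_forall_mulVec]
  intro z v hv hz
  set x : Fin n → ℝ := fun i => (v i).re
  set y : Fin n → ℝ := fun i => (v i).im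
  have hle (x : Fin n → ℝ) : P *ᵥ x ⬝ᵥ M *ᵥ x ≤ 0 := by
    rcases eq_or_ne x 0 with rfl | hx
    · simp
    · exact (h x hx).le
  have hsum : P *ᵥ x ⬝ᵥ M *ᵥ x + P *ᵥ y ⬝ᵥ M *ᵥ y < 0 := by
    have hxy : x ≠ 0 ∨ y ≠ 0 := by
      contrapose! hv
      exact funext fun i => Complex.ext (congrFun hv.1 i) (congrFun hv.2 i)
    rcases hxy with hx | hy
    · exact add_neg_of_neg_of_nonpos (h x hx) (hle y)
    · exact add_neg_of_nonpos_of_neg (hle x) (h y hy)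
  have hsymm : P *ᵥ y ⬝ᵥ x = P *ᵥ x ⬝ᵥ y := by
    rw [dotProduct_comm, dotProduct_mulVec, ← mulVec_transpose,
      (isHermitian_iff_isSymm.mp hP.isHermitian).eq]
  rw [re_mulVec_of_map_mulVec_eq_smul hz, im_mulVec_of_map_mulVec_eq_smul hz, dotProduct_sub,
    dotProduct_add, dotProduct_smul, dotProduct_smul, dotProduct_smul, dotProduct_smul, hsymm,
    sub_add_add_cancel, ← smul_add, smul_eq_mul] at hsum
  have hnonneg (x : Fin n → ℝ) : 0 ≤ P *ᵥ x ⬝ᵥ x := by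
    simpa [dotProduct_comm] using hP.dotProduct_mulVec_nonneg x
  exact neg_of_mul_neg_left hsum (add_nonneg (hnonneg x) (hnonneg y))

theorem isHurwitz_of_lyapunov (hP : P.PosSemidef) (hW : W.PosDef)
    (h : P * M + Mᵀ * P + W = 0) : IsHurwitz M := by
  refine isHurwitz_of_forall_dotProduct_neg hP fun x hx => ?_
  have hform := two_mul_dotProduct_of_lyapunov (isHermitian_iff_isSymm.mp hP.isHermitian) h x
  have hpos : 0 < x ⬝ᵥ W *ᵥ x := hW.dotProduct_mulVec_pos hx
  linarith

theorem isOpen_setOf_isHurwitz : IsOpen {M : Matrix (Fin n) (Fin n) ℝ | IsHurwitz M} := by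
  rw [isOpen_iff_mem_nhds]
  intro M hM
  have hM : IsHurwitz M := hM
  have hP := hM.posDef_lyapunovSolution PosDef.one
  have hPsymm := isHermitian_iff_isSymm.mp hP.isHermitian
  set P := lyapunovSolution M 1
  have hform (N : Matrix (Fin n) (Fin n) ℝ) (x : Fin n → ℝ) :
      x ⬝ᵥ -(P * N) *ᵥ x = -(P *ᵥ x ⬝ᵥ N *ᵥ x) := by
    rw [neg_mulVec, dotProduct_neg, ← mulVec_mulVec, dotProduct_mulVec x P, ← mulVec_transpose,
      hPsymm.eq]
  have hcont : Continuous fun N : Matrix (Fin n) (Fin n) ℝ => -(P * N) := by fun_prop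
  have hmem : -(P * M) ∈ {X : Matrix (Fin n) (Fin n) ℝ | ∀ x, x ≠ 0 → 0 < x ⬝ᵥ X *ᵥ x} := by
    intro x hx
    have hlyap := two_mul_dotProduct_of_lyapunov hPsymm
      (lyapunovSolution_spec hM.isInvertible_lyapunovMap 1) x
    have hpos : 0 < x ⬝ᵥ (1 : Matrix (Fin n) (Fin n) ℝ) *ᵥ x :=
      PosDef.one.dotProduct_mulVec_pos hx
    rw [hform]
    linarith
  filter_upwards [hcont.continuousAt.eventually_mem
    (isOpen_setOf_forall_dotProduct_mulVec_pos.mem_nhds hmem)] with N hN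
  refine isHurwitz_of_forall_dotProduct_neg hP.posSemidef fun x hx => ?_
  have hpos := hN x hx
  rw [hform] at hpos
  exact neg_pos.mp hpos

end Hurwitz

section Stabilizability

variable {n m : ℕ} {A Z : Matrix (Fin n) (Fin n) ℝ} {B : Matrix (Fin n) (Fin m) ℝ} {β : ℝ}

theorem IsControllable.eq_zero_of_forall_vecMul (h : IsControllable A B) {x : Fin n → ℝ}
    (hx : ∀ k : ℕ, x ᵥ* (A ^ k * B) = 0) : x = 0 := by
  have hrows : LinearIndependent ℝ (controllabilityMatrix A B).row := by
    rw [linearIndependent_iff_card_eq_finrank_span, Set.finrank, ← rank_eq_finrank_span_row,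
      Fintype.card_fin]
    exact h.symm
  refine vecMul_injective_iff.mpr hrows ?_
  ext p
  simpa [vecMul, dotProduct, controllabilityMatrix] using congrFun (hx p.1) p.2

theorem IsControllable.ne_zero (h : IsControllable A B) (hn : 0 < n) : B ≠ 0 := by
  rintro rfl
  have hone := h.eq_zero_of_forall_vecMul (x := fun _ => 1) fun k => by simp
  exact one_ne_zero (congrFun hone ⟨0, hn⟩)

theorem IsControllable.posDef_of_lyapunov (h : IsControllable A B) (hZ : Z.PosSemidef)
    (hlyap : Z * (-Aᵀ - β • 1) + (-Aᵀ - β • 1)ᵀ * Z + B * Bᵀ = 0) : Z.PosDef := by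
  have hker {x : Fin n → ℝ} (hx : Z *ᵥ x = 0) : Bᵀ *ᵥ x = 0 ∧ Z *ᵥ (Aᵀ *ᵥ x) = 0 := by
    obtain ⟨hBx, hAx⟩ := mulVec_eq_zero_of_lyapunov (isHermitian_iff_isSymm.mp hZ.isHermitian)
      (posSemidef_mul_transpose_self B) hlyap hx
    constructor
    · rw [← conjTranspose_eq_transpose_of_trivial] at hBx ⊢
      exact (self_mul_conjTranspose_mulVec_eq_zero B x).mp hBx
    · simpa [sub_mulVec, neg_mulVec, smul_mulVec, mulVec_sub, mulVec_neg, mulVec_smul, hx]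
        using hAx
  have hpow (k : ℕ) {x : Fin n → ℝ} (hx : Z *ᵥ x = 0) : x ᵥ* (A ^ k * B) = 0 := by
    induction k generalizing x with
    | zero => rw [pow_zero, Matrix.one_mul, ← mulVec_transpose, (hker hx).1]
    | succ k ih =>
      rw [pow_succ', Matrix.mul_assoc, ← vecMul_vecMul, ← mulVec_transpose A, ih (hker hx).2]
  rw [hZ.posDef_iff_isUnit, isUnit_iff_isUnit_det, isUnit_iff_ne_zero, ne_eq,
    ← exists_mulVec_eq_zero_iff]
  rintro ⟨x, hx, hZx⟩
  exact hx (h.eq_zero_of_forall_vecMul fun k => hpow k hZx)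

/-- Bass's stabilizing gain: `Z` is a Lyapunov certificate for the transposed closed loop, with
weight `B Bᵀ + 2 β Z`. -/
theorem mem_stabilizing_of_lyapunov (hZ : Z.PosDef) (hβ : 0 < β)
    (hlyap : Z * (-Aᵀ - β • 1) + (-Aᵀ - β • 1)ᵀ * Z + B * Bᵀ = 0) :
    Bᵀ * Z⁻¹ ∈ stabilizing A B := by
  have hZdet : IsUnit Z.det := (isUnit_iff_isUnit_det Z).mp hZ.isUnit
  have hclosed : (A - B * (Bᵀ * Z⁻¹)) * Z = A * Z - B * Bᵀ := by
    rw [Matrix.sub_mul, Matrix.mul_assoc B, nonsing_inv_mul_cancel_right _ _ hZdet]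
  have hclosed' : Z * (A - B * (Bᵀ * Z⁻¹))ᵀ = Z * Aᵀ - B * Bᵀ := by
    simpa [(isHermitian_iff_isSymm.mp hZ.isHermitian).eq] using congrArg transpose hclosed
  have hdual : IsHurwitz (A - B * (Bᵀ * Z⁻¹))ᵀ := by
    refine isHurwitz_of_lyapunov hZ.posSemidef
      (PosDef.posSemidef_add (posSemidef_mul_transpose_self B) (hZ.smul (mul_pos two_pos hβ))) ?_
    rw [transpose_transpose, hclosed, hclosed', ← neg_eq_zero, ← hlyap]
    simp only [transpose_sub, transpose_neg, transpose_transpose, transpose_smul, transpose_one,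
      Matrix.mul_sub, Matrix.sub_mul, Matrix.mul_neg, Matrix.neg_mul, Matrix.mul_smul,
      Matrix.smul_mul, Matrix.mul_one, Matrix.one_mul]
    module
  have hprimal := hdual.transpose
  rw [transpose_transpose] at hprimal
  exact hprimal

theorem IsControllable.stabilizing_nonempty (h : IsControllable A B) :
    (stabilizing A B).Nonempty := by
  obtain ⟨β, hβ, hshift⟩ := exists_isHurwitz_sub_smul_one (-Aᵀ)
  have hlyap := lyapunovSolution_spec hshift.isInvertible_lyapunovMap (B * Bᵀ)
  have hZ := hshift.posSemidef_lyapunovSolution (posSemidef_mul_transpose_self B)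
  exact ⟨_, mem_stabilizing_of_lyapunov (h.posDef_of_lyapunov hZ hlyap) hβ hlyap⟩

end Stabilizability

section Cost

variable {n m : ℕ} {A Q P : Matrix (Fin n) (Fin n) ℝ} {B : Matrix (Fin n) (Fin m) ℝ}
  {R : Matrix (Fin m) (Fin m) ℝ} {K : Matrix (Fin m) (Fin n) ℝ}

theorem solvesLyapunov_iff (hK : K ∈ stabilizing A B) :
    SolvesLyapunov A B Q R K P ↔ P = lyapunovSolution (A - B * K) (Kᵀ * R * K + Q) := by
  rw [eq_lyapunovSolution_iff (IsHurwitz.isInvertible_lyapunovMap hK), SolvesLyapunov,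
    add_assoc _ _ Q]

theorem existsUnique_solvesLyapunov (hK : K ∈ stabilizing A B) :
    ∃! P, SolvesLyapunov A B Q R K P :=
  ⟨_, (solvesLyapunov_iff hK).mpr rfl, fun _ => (solvesLyapunov_iff hK).mp⟩

theorem solvesLyapunov_iff_eq_lyapunovP (hK : K ∈ stabilizing A B) :
    SolvesLyapunov A B Q R K P ↔ P = lyapunovP A B Q R K := by
  have hex : ∃ P, SolvesLyapunov A B Q R K P := (existsUnique_solvesLyapunov hK).exists
  rw [lyapunovP, dif_pos hex]
  exact ⟨fun h => (existsUnique_solvesLyapunov hK).unique h hex.choose_spec,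
    fun h => h ▸ hex.choose_spec⟩

theorem solvesLyapunov_lyapunovP (hK : K ∈ stabilizing A B) :
    SolvesLyapunov A B Q R K (lyapunovP A B Q R K) :=
  (solvesLyapunov_iff_eq_lyapunovP hK).mpr rfl

theorem lyapunovP_eq_lyapunovSolution (hK : K ∈ stabilizing A B) :
    lyapunovP A B Q R K = lyapunovSolution (A - B * K) (Kᵀ * R * K + Q) :=
  (solvesLyapunov_iff hK).mp (solvesLyapunov_lyapunovP hK)

theorem isOpen_stabilizing (A : Matrix (Fin n) (Fin n) ℝ) (B : Matrix (Fin n) (Fin m) ℝ) :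
    IsOpen (stabilizing A B) :=
  isOpen_setOf_isHurwitz.preimage (f := fun K => A - B * K) (by fun_prop)

theorem differentiableAt_cost (hK : K ∈ stabilizing A B) :
    DifferentiableAt ℝ (cost A B Q R) K := by
  have hid : DifferentiableAt ℝ (fun X : Matrix (Fin m) (Fin n) ℝ => X) K := differentiableAt_id
  have hclosed : DifferentiableAt ℝ (fun X => A - B * X) K :=
    (differentiableAt_const A).sub (differentiableAt_mul (differentiableAt_const B) hid)
  have hweight : DifferentiableAt ℝ (fun X => Xᵀ * R * X + Q) K :=
    (differentiableAt_mul (differentiableAt_mul (differentiableAt_transpose hid)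
      (differentiableAt_const R)) hid).add (differentiableAt_const Q)
  have hsol := differentiableAt_lyapunovSolution (F := fun X => A - B * X)
    (IsHurwitz.isInvertible_lyapunovMap hK) hclosed hweight
  have htrace : DifferentiableAt ℝ
      (fun X => (lyapunovSolution (A - B * X) (Xᵀ * R * X + Q)).trace) K :=
    (traceLinearMap (Fin n) ℝ ℝ).toContinuousLinearMap.differentiableAt.comp K hsol
  refine htrace.congr_of_eventuallyEq ?_
  filter_upwards [(isOpen_stabilizing A B).mem_nhds hK] with X hX
  rw [cost, lyapunovP_eq_lyapunovSolution hX]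

theorem posDef_transpose_mul_mul_add (hQ : Q.PosDef) (hR : R.PosSemidef)
    (K : Matrix (Fin m) (Fin n) ℝ) : (Kᵀ * R * K + Q).PosDef :=
  PosDef.posSemidef_add (posSemidef_transpose_mul_mul_same hR K) hQ

theorem posDef_lyapunovP (hQ : Q.PosDef) (hR : R.PosSemidef) (hK : K ∈ stabilizing A B) :
    (lyapunovP A B Q R K).PosDef :=
  lyapunovP_eq_lyapunovSolution hK ▸
    IsHurwitz.posDef_lyapunovSolution hK (posDef_transpose_mul_mul_add hQ hR K)

theorem cost_nonneg (hQ : Q.PosDef) (hR : R.PosSemidef) (hK : K ∈ stabilizing A B) :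
    0 ≤ cost A B Q R K :=
  (posDef_lyapunovP hQ hR hK).posSemidef.trace_nonneg

theorem mem_stabilizing_of_solvesLyapunov (hQ : Q.PosDef) (hR : R.PosSemidef) (hP : P.PosSemidef)
    (h : SolvesLyapunov A B Q R K P) : K ∈ stabilizing A B := by
  rw [SolvesLyapunov, add_assoc _ _ Q] at h
  exact isHurwitz_of_lyapunov hP (posDef_transpose_mul_mul_add hQ hR K) h

theorem cost_le_trace {S : Matrix (Fin n) (Fin n) ℝ} (hK : K ∈ stabilizing A B)
    (hS : (-(S * (A - B * K) + (A - B * K)ᵀ * S + Kᵀ * R * K + Q)).PosSemidef) :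
    cost A B Q R K ≤ S.trace := by
  have hsub : S - lyapunovP A B Q R K = lyapunovSolution (A - B * K)
      (-(S * (A - B * K) + (A - B * K)ᵀ * S + Kᵀ * R * K + Q)) := by
    have hsolves : SolvesLyapunov A B Q R K (lyapunovP A B Q R K) := solvesLyapunov_lyapunovP hK
    rw [eq_lyapunovSolution_iff (IsHurwitz.isInvertible_lyapunovMap hK), ← neg_eq_zero, ← hsolves]
    simp only [sub_mul S, mul_sub _ S]
    abel
  have hnonneg := (hsub ▸ IsHurwitz.posSemidef_lyapunovSolution hK hS).trace_nonneg
  rwa [trace_sub, sub_nonneg] at hnonneg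

end Cost

section ImprovedGain

variable {n m : ℕ} {A Q P : Matrix (Fin n) (Fin n) ℝ} {B : Matrix (Fin n) (Fin m) ℝ}
  {R : Matrix (Fin m) (Fin m) ℝ} {K : Matrix (Fin m) (Fin n) ℝ}

/-- The gain `R⁻¹ Bᵀ P` produced from the value matrix `P` by one step of policy improvement. -/
noncomputable def improvedGain (B : Matrix (Fin n) (Fin m) ℝ) (R : Matrix (Fin m) (Fin m) ℝ)
    (P : Matrix (Fin n) (Fin n) ℝ) : Matrix (Fin m) (Fin n) ℝ :=
  R⁻¹ * Bᵀ * P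

theorem mul_improvedGain (hR : IsUnit R) : R * improvedGain B R P = Bᵀ * P := by
  rw [improvedGain, Matrix.mul_assoc,
    mul_nonsing_inv_cancel_left _ _ ((isUnit_iff_isUnit_det R).mp hR)]

theorem improvedGain_ne_zero (hR : IsUnit R) (hP : IsUnit P) (hB : B ≠ 0) :
    improvedGain B R P ≠ 0 := by
  intro h
  have hBP := mul_improvedGain (B := B) (P := P) hR
  rw [h, Matrix.mul_zero] at hBP
  refine hB (transpose_eq_zero.mp ?_)
  rw [← mul_nonsing_inv_cancel_right P Bᵀ ((isUnit_iff_isUnit_det P).mp hP), ← hBP,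
    Matrix.zero_mul]

theorem lyapunov_closedLoop_eq (hR : R.PosDef) (hP : P.IsSymm) (K : Matrix (Fin m) (Fin n) ℝ) :
    P * (A - B * K) + (A - B * K)ᵀ * P = P * A + Aᵀ * P
      - (improvedGain B R P)ᵀ * R * K - Kᵀ * R * improvedGain B R P := by
  have hleft : R * improvedGain B R P = Bᵀ * P := mul_improvedGain hR.isUnit
  have hright : (improvedGain B R P)ᵀ * R = P * B := by
    simpa [(isHermitian_iff_isSymm.mp hR.isHermitian).eq, hP.eq] using congrArg transpose hleft
  rw [hright, Matrix.mul_assoc Kᵀ, hleft]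
  simp only [transpose_sub, transpose_mul, Matrix.mul_sub, Matrix.sub_mul, Matrix.mul_assoc]
  abel

theorem SolvesLyapunov.transpose_sub_improvedGain_mul_mul (hR : R.PosDef) (hP : P.IsSymm)
    (h : SolvesLyapunov A B Q R K P) :
    (K - improvedGain B R P)ᵀ * R * (K - improvedGain B R P) =
      (improvedGain B R P)ᵀ * R * improvedGain B R P - (P * A + Aᵀ * P + Q) := by
  rw [SolvesLyapunov, lyapunov_closedLoop_eq hR hP] at h
  rw [← sub_eq_zero, ← h]
  simp only [transpose_sub, Matrix.mul_sub, Matrix.sub_mul]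
  abel

theorem isCompact_setOf_solvesLyapunov (hR : R.PosDef) (a : ℝ) :
    IsCompact {p : Matrix (Fin m) (Fin n) ℝ × Matrix (Fin n) (Fin n) ℝ |
      SolvesLyapunov A B Q R p.1 p.2 ∧ p.2.PosSemidef ∧ p.2.trace ≤ a} := by
  have hgain : Continuous (improvedGain B R) := by unfold improvedGain; fun_prop
  have hD := isCompact_setOf_posSemidef_trace_le (ι := Fin n) a
  obtain ⟨c, hc, hnorm⟩ := exists_norm_sq_le_mul_trace (ι := Fin n) hR
  obtain ⟨b, hb⟩ := (hD.image (f := fun P => ((improvedGain B R P)ᵀ * R * improvedGain B R P -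
    (P * A + Aᵀ * P + Q)).trace) (by fun_prop)).bddAbove
  have hbox := (isCompact_closedBall (0 : Matrix (Fin m) (Fin n) ℝ) √(c * b)).prod hD
  refine (hbox.image (f := fun p => (p.1 + improvedGain B R p.2, p.2))
    (by fun_prop)).of_isClosed_subset ?_ ?_
  · exact (isClosed_eq (by fun_prop) continuous_const).inter
      (hD.isClosed.preimage continuous_snd)
  · rintro ⟨K, P⟩ ⟨hsolves, hP⟩
    refine ⟨(K - improvedGain B R P, P), ⟨mem_closedBall_zero_iff.mpr ?_, hP⟩, by simp⟩
    refine Real.le_sqrt_of_sq_le ((hnorm _).trans (mul_le_mul_of_nonneg_left ?_ hc))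
    rw [hsolves.transpose_sub_improvedGain_mul_mul hR
      (isHermitian_iff_isSymm.mp hP.1.isHermitian)]
    exact hb ⟨P, hP, rfl⟩

theorem isCompact_sublevel_cost (hQ : Q.PosDef) (hR : R.PosDef) (a : ℝ) :
    IsCompact {K | K ∈ stabilizing A B ∧ cost A B Q R K ≤ a} := by
  convert (isCompact_setOf_solvesLyapunov (A := A) (B := B) (Q := Q) hR a).image continuous_fst
    using 1
  ext K
  constructor
  · rintro ⟨hK, hcost⟩
    exact ⟨(K, lyapunovP A B Q R K), ⟨solvesLyapunov_lyapunovP hK,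
      (posDef_lyapunovP hQ hR.posSemidef hK).posSemidef, hcost⟩, rfl⟩
  · rintro ⟨⟨K, P⟩, ⟨hsolves, hP, htrace⟩, rfl⟩
    have hK := mem_stabilizing_of_solvesLyapunov hQ hR.posSemidef hP hsolves
    refine ⟨hK, ?_⟩
    rwa [cost, ← (solvesLyapunov_iff_eq_lyapunovP hK).mp hsolves]

theorem SolvesLyapunov.lyapunov_add_smul_improvedGain (hR : R.PosDef) (hP : P.IsSymm)
    (h : SolvesLyapunov A B Q R K P) (ρ : ℝ) :
    P * (A - B * (K + ρ • improvedGain B R P)) + (A - B * (K + ρ • improvedGain B R P))ᵀ * P =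
      -(Kᵀ * R * K + (2 * ρ) • ((improvedGain B R P)ᵀ * R * improvedGain B R P) + Q) := by
  rw [SolvesLyapunov, lyapunov_closedLoop_eq hR hP] at h
  rw [lyapunov_closedLoop_eq hR hP, ← sub_eq_zero, ← h]
  simp only [transpose_add, transpose_smul, Matrix.mul_add, Matrix.add_mul, Matrix.mul_smul,
    Matrix.smul_mul]
  module

theorem add_smul_improvedGain_mem_stabilizing (hQ : Q.PosDef) (hR : R.PosDef) (hP : P.PosSemidef)
    (h : SolvesLyapunov A B Q R K P) {ρ : ℝ} (hρ : 0 ≤ ρ) :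
    K + ρ • improvedGain B R P ∈ stabilizing A B := by
  have hweight : (Kᵀ * R * K + (2 * ρ) • ((improvedGain B R P)ᵀ * R * improvedGain B R P)
      + Q).PosDef :=
    PosDef.posSemidef_add ((posSemidef_transpose_mul_mul_same hR.posSemidef K).add
      ((posSemidef_transpose_mul_mul_same hR.posSemidef _).smul (by positivity))) hQ
  refine isHurwitz_of_lyapunov hP hweight ?_
  rw [h.lyapunov_add_smul_improvedGain hR (isHermitian_iff_isSymm.mp hP.isHermitian),
    neg_add_cancel]

theorem cost_add_smul_improvedGain_le (hQ : Q.PosDef) (hR : R.PosDef) (hP : P.PosSemidef)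
    (h : SolvesLyapunov A B Q R K P) {ρ : ℝ} (hρ : 2 ≤ ρ) :
    cost A B Q R (K + ρ • improvedGain B R P) ≤ ρ * P.trace := by
  have hRR (Y : Matrix (Fin m) (Fin n) ℝ) := posSemidef_transpose_mul_mul_same hR.posSemidef Y
  rw [← smul_eq_mul, ← trace_smul]
  refine cost_le_trace (add_smul_improvedGain_mem_stabilizing hQ hR hP h (by linarith)) ?_
  set G := improvedGain B R P with hG
  suffices hresidual : -((ρ • P) * (A - B * (K + ρ • G)) + (A - B * (K + ρ • G))ᵀ * (ρ • P) +
      (K + ρ • G)ᵀ * R * (K + ρ • G) + Q) =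
      (ρ - 1) • Q + (ρ - 2) • (Kᵀ * R * K) + (K - ρ • G)ᵀ * R * (K - ρ • G) by
    rw [hresidual]
    exact ((hQ.posSemidef.smul (by linarith)).add ((hRR K).smul (by linarith))).add (hRR _)
  rw [Matrix.smul_mul, Matrix.mul_smul, ← smul_add,
    h.lyapunov_add_smul_improvedGain hR (isHermitian_iff_isSymm.mp hP.isHermitian), ← hG]
  simp only [transpose_sub, transpose_add, transpose_smul, Matrix.mul_sub, Matrix.sub_mul,
    Matrix.mul_add, Matrix.add_mul, Matrix.smul_mul, Matrix.mul_smul]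
  module

end ImprovedGain

section Gradient

variable {n m : ℕ}

theorem frobeniusNorm_eq_norm (M : Matrix (Fin m) (Fin n) ℝ) : frobeniusNorm M = ‖M‖ := by
  simp [frobeniusNorm, frobenius_norm_def, Real.sqrt_eq_rpow]

theorem fderiv_apply_eq_sum (f : Matrix (Fin m) (Fin n) ℝ → ℝ) (K H : Matrix (Fin m) (Fin n) ℝ) :
    fderiv ℝ f K H = ∑ i, ∑ j, H i j * matrixGradient f K i j := by
  conv_lhs => rw [matrix_eq_sum_single H]
  simp only [map_sum]
  refine Finset.sum_congr rfl fun i _ => Finset.sum_congr rfl fun j _ => ?_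
  have hsingle : single i j (H i j) = H i j • single i j (1 : ℝ) := by
    rw [smul_single, smul_eq_mul, mul_one]
  rw [hsingle, map_smul, smul_eq_mul, matrixGradient, of_apply]

/-- Stated with a bound on values because `fderiv` here refers to the entrywise topology of
matrices, for which there is no operator norm instance. -/
theorem frobeniusNorm_matrixGradient_le {f : Matrix (Fin m) (Fin n) ℝ → ℝ}
    {K : Matrix (Fin m) (Fin n) ℝ} {C : ℝ} (hC : 0 ≤ C) (hf : ∀ H, ‖fderiv ℝ f K H‖ ≤ C * ‖H‖) :
    frobeniusNorm (matrixGradient f K) ≤ C := by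
  have hself : ‖matrixGradient f K‖ * ‖matrixGradient f K‖ =
      fderiv ℝ f K (matrixGradient f K) := by
    rw [← frobeniusNorm_eq_norm, frobeniusNorm, Real.mul_self_sqrt (by positivity),
      fderiv_apply_eq_sum]
    simp only [sq]
  rw [frobeniusNorm_eq_norm]
  rcases (norm_nonneg (matrixGradient f K)).eq_or_lt with hzero | hpos
  · rwa [← hzero]
  · exact le_of_mul_le_mul_right (hself.trans_le ((Real.le_norm_self _).trans (hf _))) hpos

end Gradient

theorem not_polyakLojasiewicz_cost {n m : ℕ} {A Q : Matrix (Fin n) (Fin n) ℝ}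
    {B : Matrix (Fin n) (Fin m) ℝ} {R : Matrix (Fin m) (Fin m) ℝ} {a : ℝ}
    (hstab : (stabilizing A B).Nonempty) (hB : B ≠ 0) (hQ : Q.PosDef) (hR : R.PosDef)
    (ha : ∀ K ∈ stabilizing A B, a ≤ cost A B Q R K) :
    ¬ ∃ μ : ℝ, 0 < μ ∧ ∀ K ∈ stabilizing A B,
      frobeniusNorm (matrixGradient (cost A B Q R) K) ≥ √(μ * (cost A B Q R K - a)) := by
  rintro ⟨μ, hμ, hPL⟩
  obtain ⟨K, hK⟩ := hstab
  have hP := posDef_lyapunovP hQ hR.posSemidef hK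
  have hsolves : SolvesLyapunov A B Q R K _ := solvesLyapunov_lyapunovP hK
  refine not_polyakLojasiewiczOn_of_ray (x₀ := K) (C := cost A B Q R K) (isOpen_stabilizing A B)
    (fun X hX => (differentiableAt_cost hX).differentiableWithinAt)
    (isCompact_sublevel_cost hQ hR) ha (improvedGain_ne_zero hR.isUnit hP.isUnit hB) ?_ hμ
    fun X hX => (hPL X hX).trans (frobeniusNorm_matrixGradient_le (norm_nonneg _)
      (ContinuousLinearMap.le_opNorm _))
  filter_upwards [eventually_ge_atTop 2] with ρ hρ
  exact ⟨add_smul_improvedGain_mem_stabilizing hQ hR hP.posSemidef hsolves (by linarith),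
    cost_add_smul_improvedGain_le hQ hR hP.posSemidef hsolves hρ⟩

end CTLQR

theorem mainTheorem1_general {n m : ℕ}
    (A : Matrix (Fin n) (Fin n) ℝ) (B : Matrix (Fin n) (Fin m) ℝ)
    (Q : Matrix (Fin n) (Fin n) ℝ) (R : Matrix (Fin m) (Fin m) ℝ)
    (hstab : (CTLQR.stabilizing A B).Nonempty) (hB : B ≠ 0) (hQ : Q.PosDef) (hR : R.PosDef) :
    (∀ K ∈ CTLQR.stabilizing A B, ∃! P, CTLQR.SolvesLyapunov A B Q R K P) ∧
    (∀ K ∈ CTLQR.stabilizing A B, DifferentiableAt ℝ (CTLQR.cost A B Q R) K) ∧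
    (¬ ∃ μ : ℝ, 0 < μ ∧ ∀ K ∈ CTLQR.stabilizing A B,
      CTLQR.frobeniusNorm (CTLQR.matrixGradient (CTLQR.cost A B Q R) K) ≥
        Real.sqrt (μ * (CTLQR.cost A B Q R K -
          sInf (CTLQR.cost A B Q R '' CTLQR.stabilizing A B)))) ∧
    (∀ Kstar ∈ CTLQR.stabilizing A B,
      IsMinOn (CTLQR.cost A B Q R) (CTLQR.stabilizing A B) Kstar →
      ¬ ∃ μ : ℝ, 0 < μ ∧ ∀ K ∈ CTLQR.stabilizing A B,
        CTLQR.frobeniusNorm (CTLQR.matrixGradient (CTLQR.cost A B Q R) K) ≥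
          Real.sqrt (μ * (CTLQR.cost A B Q R K - CTLQR.cost A B Q R Kstar))) := by
  refine ⟨fun K hK => CTLQR.existsUnique_solvesLyapunov hK,
    fun K hK => CTLQR.differentiableAt_cost hK,
    CTLQR.not_polyakLojasiewicz_cost hstab hB hQ hR fun K hK => csInf_le ⟨0, ?_⟩ ⟨K, hK, rfl⟩,
    fun Kstar _ hmin => CTLQR.not_polyakLojasiewicz_cost hstab hB hQ hR fun K hK => hmin hK⟩
  rintro _ ⟨K, hK, rfl⟩
  exact CTLQR.cost_nonneg hQ hR.posSemidef hK

theorem mainTheorem1 {n m : ℕ} (hn : 0 < n)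
    (A : Matrix (Fin n) (Fin n) ℝ) (B : Matrix (Fin n) (Fin m) ℝ)
    (Q : Matrix (Fin n) (Fin n) ℝ) (R : Matrix (Fin m) (Fin m) ℝ)
    (hAB : CTLQR.IsControllable A B) (hQ : Q.PosDef) (hR : R.PosDef) :
    -- `P_K` is well defined and `J` is differentiable at every stabilizing gain
    (∀ K ∈ CTLQR.stabilizing A B, ∃! P, CTLQR.SolvesLyapunov A B Q R K P) ∧
    (∀ K ∈ CTLQR.stabilizing A B, DifferentiableAt ℝ (CTLQR.cost A B Q R) K) ∧
    -- no global PL inequality relative to the infimum of `J` over the stabilizing gains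
    (¬ ∃ μ : ℝ, 0 < μ ∧ ∀ K ∈ CTLQR.stabilizing A B,
      CTLQR.frobeniusNorm (CTLQR.matrixGradient (CTLQR.cost A B Q R) K) ≥
        Real.sqrt (μ * (CTLQR.cost A B Q R K -
          sInf (CTLQR.cost A B Q R '' CTLQR.stabilizing A B)))) ∧
    -- the same with `J(K*)` for a minimizer `K*`
    (∀ Kstar ∈ CTLQR.stabilizing A B,
      IsMinOn (CTLQR.cost A B Q R) (CTLQR.stabilizing A B) Kstar →
      ¬ ∃ μ : ℝ, 0 < μ ∧ ∀ K ∈ CTLQR.stabilizing A B,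
        CTLQR.frobeniusNorm (CTLQR.matrixGradient (CTLQR.cost A B Q R) K) ≥
          Real.sqrt (μ * (CTLQR.cost A B Q R K - CTLQR.cost A B Q R Kstar))) :=
  mainTheorem1_general A B Q R hAB.stabilizing_nonempty (hAB.ne_zero hn) hQ hR
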